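/- Let $p$ be a prime, let $L$ be a finite-dimensional solvable restricted Lie algebra over a field $\mathbb{F}$ of characteristic $p$, with $p$-map $x\mapsto x^{[p]}$, and let $\chi$ be a linear form on $L$. Write $u(L,\chi)$ for the $\chi$-reduced universal enveloping algebra, that is, the quotient of the universal enveloping algebra $U(L)$ by the two-sided ideal generated by the elements $x^p-x^{[p]}-\chi(x)^p\cdot 1$ ($x\in L$). An $L$-module $V$ has $p$-character $\chi$ if $(x_V)^p-(x^{[p]})_V=\chi(x)^p\,\mathrm{id}_V$ for all $x\in L$, where $x_V$ denotes the action of $x$ on $V$; such modules are the same as $u(L,\chi)$-modules. For such a $V$, the projective cover $P_L(V)$ is a projective $u(L,\chi)$-module with an epimorphism onto $V$ whose kernel is contained in the radical of $P_L(V)$. For a $p$-subalgebra $H$ of $L$ (a Lie subalgebra closed under $x\mapsto x^{[p]}$) and an $H$-module $V$ with $p$-character $\chi|_H$, put $\mathrm{Ind}_H^L(V,\chi):=u(L,\chi)\otimes_{u(H,\chi|_H)}V$. A torus of $L$ is an abelian $p$-subalgebra $T$ all of whose elements $x$ are semisimple, i.e. $x$ lies in the $\mathbb{F}$-span of the elements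 $x^{[p]^i}$, $i\ge 1$; a maximal torus is a torus that is maximal with respect to inclusion. If $S$ is a one-dimensional $L$-module with $p$-character $\chi$, then for every maximal torus $T$ of $L$ there is an isomorphism of $u(L,\chi)$-modules $$P_L(S)\cong\mathrm{Ind}_T^L(S|_T,\chi).$$ That is, $\mathrm{Ind}_T^L(S|_T,\chi)$ admits a homomorphism onto $S$ making it a projective cover of $S$ over $u(L,\chi)$, and every projective cover of $S$ over $u(L,\chi)$ is isomorphic to it. -/

import Mathlib

open scoped TensorProduct

universe u v w x

section RestrictedLieAlgebras

/-- The Lie polynomials `s_i(a, b)` in Jacobson's formula, characterised by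
`(ad (a ⊗ X + b ⊗ 1)) ^ (p - 1) (a ⊗ 1) = ∑_{i = 1}^{p - 1} i s_i(a, b) ⊗ X ^ (i - 1)`
in `L ⊗ F[X]`. The operator `ad (a ⊗ X + b ⊗ 1)` is written as the polynomial
`(ad a) X + ad b` with coefficients in the (noncommutative) ring `End F L`. -/
noncomputable def jacobsonTerm (p : ℕ) (F : Type u) {L : Type v} [Field F] [LieRing L]
    [LieAlgebra F L] (i : ℕ) (a b : L) : L :=
  (i : F)⁻¹ •
    (((Polynomial.C (LieAlgebra.ad F L a) * Polynomial.X +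
      Polynomial.C (LieAlgebra.ad F L b)) ^ (p - 1)).coeff (i - 1)) a

/-- A restricted Lie algebra `(L, [p])` over a field `F` (of prime characteristic `p`):
a Lie algebra with a `p`-map `x ↦ x^[p]`. -/
class RestrictedLieAlgebra (p : ℕ) (F : Type u) (L : Type v) [Field F] [LieRing L]
    [LieAlgebra F L] where
  /-- the `p`-map `x ↦ x^[p]` -/
  pMap : L → L
  ad_pMap : ∀ a : L, LieAlgebra.ad F L (pMap a) = (LieAlgebra.ad F L a) ^ p
  pMap_smul : ∀ (c : F) (a : L), pMap (c • a) = c ^ p • pMap a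
  pMap_add : ∀ a b : L,
    pMap (a + b) = pMap a + pMap b + ∑ i ∈ Finset.Icc 1 (p - 1), jacobsonTerm p F i a b

variable (p : ℕ) (F : Type u) (L : Type v) [Field F] [LieRing L] [LieAlgebra F L]

/-- The `p`-map `x ↦ x^[p]` of a restricted Lie algebra. -/
def pMap {L : Type v} [LieRing L] [LieAlgebra F L] [RestrictedLieAlgebra p F L] : L → L :=
  RestrictedLieAlgebra.pMap p F

/-- A `p`-subalgebra: a Lie subalgebra closed under the `p`-map. -/
structure PSubalgebra [RestrictedLieAlgebra p F L] extends LieSubalgebra F L where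
  pMap_mem : ∀ {a : L}, a ∈ carrier → pMap p F a ∈ carrier

variable {p F L}

theorem coe_coeff_ad_pow (H : LieSubalgebra F L) (a b : H) (n k : ℕ) (c : H) :
    (((((Polynomial.C (LieAlgebra.ad F H a) * Polynomial.X +
      Polynomial.C (LieAlgebra.ad F H b)) ^ n).coeff k) c : H) : L) =
    (((Polynomial.C (LieAlgebra.ad F L a) * Polynomial.X +
      Polynomial.C (LieAlgebra.ad F L b)) ^ n).coeff k) (c : L) := by
  induction n generalizing k with
  | zero =>
    by_cases hk : k = 0 <;> simp [Polynomial.coeff_one, hk]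
  | succ n ih =>
    rw [pow_succ', pow_succ', add_mul, add_mul, mul_assoc, mul_assoc]
    cases k with
    | zero => simp [ih]
    | succ k => simp [ih]

theorem coe_jacobsonTerm (H : LieSubalgebra F L) (i : ℕ) (a b : H) :
    ((jacobsonTerm p F i a b : H) : L) = jacobsonTerm p F i (a : L) (b : L) := by
  simp [jacobsonTerm, coe_coeff_ad_pow]

theorem coe_ad_pow (H : LieSubalgebra F L) (a c : H) (n : ℕ) :
    ((((LieAlgebra.ad F H a) ^ n) c : H) : L) = ((LieAlgebra.ad F L a) ^ n) (c : L) := by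
  induction n with
  | zero => simp
  | succ n ih => rw [pow_succ', pow_succ']; simp [ih]

/-- A `p`-subalgebra is a restricted Lie algebra with the restricted `p`-map. -/
instance PSubalgebra.instRestrictedLieAlgebra [RestrictedLieAlgebra p F L]
    (H : PSubalgebra p F L) : RestrictedLieAlgebra p F H.toLieSubalgebra where
  pMap a := ⟨pMap p F (a : L), H.pMap_mem a.2⟩
  ad_pMap a := by
    ext c
    rw [coe_ad_pow, ← RestrictedLieAlgebra.ad_pMap]
    simp [pMap]
  pMap_smul c a := by
    ext
    exact RestrictedLieAlgebra.pMap_smul c (a : L)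
  pMap_add a b := by
    ext
    simpa [coe_jacobsonTerm, pMap] using RestrictedLieAlgebra.pMap_add (a : L) (b : L)

@[simp]
theorem PSubalgebra.coe_pMap [RestrictedLieAlgebra p F L] (H : PSubalgebra p F L)
    (a : H.toLieSubalgebra) : ((pMap p F a : H.toLieSubalgebra) : L) = pMap p F (a : L) :=
  rfl

/-- `x` is (`p`-)semisimple: it lies in `⟨x^[p]⟩_p`, the span of `x^[p]^i`, `i ≥ 1`. -/
def IsPSemisimple (p : ℕ) (F : Type u) {L : Type v} [Field F] [LieRing L] [LieAlgebra F L]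
    [RestrictedLieAlgebra p F L] (a : L) : Prop :=
  a ∈ Submodule.span F (Set.range fun i : ℕ => (pMap p F)^[i + 1] a)

/-- A torus: an abelian `p`-subalgebra consisting of semisimple elements. -/
def PSubalgebra.IsTorus [RestrictedLieAlgebra p F L] (T : PSubalgebra p F L) : Prop :=
  IsLieAbelian T.toLieSubalgebra ∧ ∀ a ∈ T.toLieSubalgebra, IsPSemisimple p F a

/-- A maximal torus: a torus not properly contained in another torus. -/
def PSubalgebra.IsMaximalTorus [RestrictedLieAlgebra p F L] (T : PSubalgebra p F L) : Prop :=
  T.IsTorus ∧ ∀ T' : PSubalgebra p F L, T'.IsTorus →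
    T.toLieSubalgebra ≤ T'.toLieSubalgebra → T'.toLieSubalgebra ≤ T.toLieSubalgebra

end RestrictedLieAlgebras

section ReducedEnvelopingAlgebras

attribute [local instance 100] LieRing.ofAssociativeRing

variable (p : ℕ) {F : Type u} {L : Type v} [Field F] [LieRing L] [LieAlgebra F L]
  [RestrictedLieAlgebra p F L]

/-- The relations `x ^ p - x^[p] = χ(x) ^ p` in the universal enveloping algebra. -/
inductive ReducedRel (χ : Module.Dual F L) :
    UniversalEnvelopingAlgebra F L → UniversalEnvelopingAlgebra F L → Prop
  | pow (a : L) : ReducedRel χ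
      (UniversalEnvelopingAlgebra.ι F a ^ p - UniversalEnvelopingAlgebra.ι F (pMap p F a))
      (algebraMap F (UniversalEnvelopingAlgebra F L) (χ a ^ p))

/-- The `χ`-reduced universal enveloping algebra `u(L, χ)`. -/
abbrev ReducedEnveloping (χ : Module.Dual F L) : Type _ := RingQuot (ReducedRel p χ)

/-- The linear form `χ` restricted to a `p`-subalgebra. -/
def PSubalgebra.restrictForm {p : ℕ} [RestrictedLieAlgebra p F L] (H : PSubalgebra p F L)
    (χ : Module.Dual F L) : Module.Dual F H.toLieSubalgebra :=
  χ ∘ₗ (H.toLieSubalgebra.incl : H.toLieSubalgebra →ₗ[F] L)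

@[simp]
theorem PSubalgebra.restrictForm_apply {p : ℕ} [RestrictedLieAlgebra p F L]
    (H : PSubalgebra p F L) (χ : Module.Dual F L) (a : H.toLieSubalgebra) :
    H.restrictForm χ a = χ (a : L) :=
  rfl

/-- The canonical homomorphism `u(H, χ|_H) → u(L, χ)` for a `p`-subalgebra `H`. -/
noncomputable def reducedInclusion (H : PSubalgebra p F L) (χ : Module.Dual F L) :
    ReducedEnveloping p (H.restrictForm χ) →ₐ[F] ReducedEnveloping p χ :=
  RingQuot.liftAlgHom F ⟨(RingQuot.mkAlgHom F (ReducedRel p χ)).comp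
    (UniversalEnvelopingAlgebra.lift F
      ((UniversalEnvelopingAlgebra.ι F).comp H.toLieSubalgebra.incl)), by
    rintro _ _ ⟨a⟩
    have h := RingQuot.mkAlgHom_rel F (ReducedRel.pow (p := p) (χ := χ) (a : L))
    simpa [UniversalEnvelopingAlgebra.lift_ι_apply, -UniversalEnvelopingAlgebra.ι_apply]
      using h⟩

/-- The `L`-module `V` has `p`-character `χ`:
`(a_V) ^ p - (a^[p])_V = χ(a) ^ p id_V` for all `a` in `L`. -/
def HasPCharacter (χ : Module.Dual F L) (V : Type w) [AddCommGroup V] [Module F V]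
    [LieRingModule L V] [LieModule F L V] : Prop :=
  ∀ a : L, LieModule.toEnd F L V a ^ p - LieModule.toEnd F L V (pMap p F a) =
    χ a ^ p • (1 : Module.End F V)

variable {p} {χ : Module.Dual F L} {V : Type w} [AddCommGroup V] [Module F V]
  [LieRingModule L V] [LieModule F L V]

/-- The restriction `V|_H` has `p`-character `χ|_H`. -/
theorem HasPCharacter.restrict (h : HasPCharacter p χ V) (H : PSubalgebra p F L) :
    HasPCharacter p (H.restrictForm χ) V :=
  fun a => h (a : L)

/-- The action of `u(L, χ)` on an `L`-module with `p`-character `χ`. -/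
noncomputable def HasPCharacter.action (h : HasPCharacter p χ V) :
    ReducedEnveloping p χ →ₐ[F] Module.End F V :=
  RingQuot.liftAlgHom F ⟨UniversalEnvelopingAlgebra.lift F (LieModule.toEnd F L V), by
    rintro _ _ ⟨a⟩
    have := h a
    simpa [UniversalEnvelopingAlgebra.lift_ι_apply, -UniversalEnvelopingAlgebra.ι_apply,
      Algebra.algebraMap_eq_smul_one] using this⟩

/-- An `L`-module `V` with `p`-character `χ`, viewed as a `u(L, χ)`-module. -/
@[nolint unusedArguments]
def HasPCharacter.AsModule (_h : HasPCharacter p χ V) : Type w := V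

noncomputable instance (h : HasPCharacter p χ V) : AddCommGroup h.AsModule :=
  inferInstanceAs (AddCommGroup V)

noncomputable instance (h : HasPCharacter p χ V) : Module F h.AsModule :=
  inferInstanceAs (Module F V)

noncomputable instance (h : HasPCharacter p χ V) :
    Module (ReducedEnveloping p χ) h.AsModule :=
  Module.compHom V (h.action : ReducedEnveloping p χ →+* Module.End F V)

end ReducedEnvelopingAlgebras

section InductionAndCovers

/-- The tensor product `B ⊗_A V` over a possibly noncommutative `F`-algebra `A`, where `B` is a
right `A`-module via the homomorphism `f : A → B`: the quotient of the left `B`-module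
`B ⊗_F V` by the relations `b f(a) ⊗ v = b ⊗ a v`. -/
abbrev ExtendedModule {F : Type u} [Field F] {A : Type v} {B : Type w} [Ring A] [Ring B]
    [Algebra F A] [Algebra F B] (f : A →ₐ[F] B) (V : Type x) [AddCommGroup V] [Module F V]
    [Module A V] : Type _ :=
  (B ⊗[F] V) ⧸ Submodule.span B
    {t : B ⊗[F] V | ∃ (b : B) (a : A) (c : V), t = (b * f a) ⊗ₜ[F] c - b ⊗ₜ[F] (a • c)}

/-- The induced module `Ind_H^L(W, χ) = u(L, χ) ⊗_{u(H, χ|_H)} W` of an `H`-module `W` with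
`p`-character `χ|_H`. -/
abbrev InducedModule {p : ℕ} {F : Type u} {L : Type v} [Field F] [LieRing L] [LieAlgebra F L]
    [RestrictedLieAlgebra p F L] (χ : Module.Dual F L) (H : PSubalgebra p F L) {W : Type w}
    [AddCommGroup W] [Module F W] [LieRingModule H.toLieSubalgebra W]
    [LieModule F H.toLieSubalgebra W] (h : HasPCharacter p (H.restrictForm χ) W) : Type _ :=
  ExtendedModule (reducedInclusion p H χ) h.AsModule

/-- `π : P → M` is a projective cover of the `A`-module `M`: `P` is projective, `π` is surjective,
and its kernel lies in the (Jacobson) radical of `P`. -/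
def IsProjectiveCover {A : Type u} [Ring A] {P : Type v} {M : Type w} [AddCommGroup P]
    [Module A P] [AddCommGroup M] [Module A M] (π : P →ₗ[A] M) : Prop :=
  Module.Projective A P ∧ Function.Surjective π ∧ LinearMap.ker π ≤ Module.jacobson A P

end InductionAndCovers

/-! Let `ε` be the character of `u(L, χ)` on `S`. Replacing each generator `x` by `x - ε(x)` turns
`p`-character `χ` into `p`-character `0` and makes `S` trivial. The induced module is cyclic, on a
generator `g` annihilated by the shifted elements of `T`; write `π` for its natural map onto `S`.

Projectivity: a torus is spanned by its `p`-th powers, so in the commutative algebra `u(T, χ|_T)`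
the kernel of the character is an idempotent, finitely generated ideal, hence generated by an
idempotent `f` (`exists_annihilating_idempotent`). Then `e = 1 - f` affords `S|_T`, and inducing
from `T` gives a direct summand of `u(L, χ)`.

Radical: modulo a maximal submodule, `g` becomes a nonzero `T`-invariant vector of a simple module,
for the shifted action. For solvable `L` such a module is trivial
(`eq_zero_of_irreducible_of_torus_invariant`), so every `a • g` with `ε a = 0` lies in every maximal
submodule. These elements form the kernel of `π`. Triviality is proved by descent along the derived
series. The crux is that an element central modulo the kernel of the representation acts by zero:
modulo that kernel it can be moved into the centralizer of `T`, where a high `p`-power is semisimple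
and so lies in the maximal torus `T`. No weights are used, so `F` need not be algebraically closed.

Uniqueness: a map between covers splits, and its kernel is a projective module equal to its radical,
hence zero by Bass. -/

/-! ### Uniqueness of projective covers over an arbitrary ring -/

section ProjectiveCovers

variable {A : Type u} [Ring A]

/-- `1 - a` is invertible for `a` in the Jacobson radical. -/
theorem isUnit_one_sub_of_mem_jacobson {a : A} (ha : a ∈ (⊥ : Ideal A).jacobson) :
    IsUnit (1 - a) := by
  have key : ∀ b ∈ (⊥ : Ideal A).jacobson, ∃ z : A, z * (1 - b) = 1 := by
    intro b hb
    obtain ⟨z, hz⟩ := Ideal.mem_jacobson_iff.1 hb (-1)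
    refine ⟨z, ?_⟩
    rw [Ideal.mem_bot] at hz
    rw [← sub_eq_zero, ← hz]
    noncomm_ring
  obtain ⟨z, hz⟩ := key a ha
  -- The left inverse `z` equals `1 + z * a`, so it has a left inverse as well, which must then be
  -- `1 - a`.
  obtain ⟨t, ht⟩ := key (-(z * a)) (neg_mem (Ideal.mul_mem_left _ z ha))
  have hz' : 1 - -(z * a) = z := by
    rw [mul_sub, mul_one] at hz
    rw [← hz]
    abel
  rw [hz'] at ht
  have : t = 1 - a := left_inv_eq_right_inv ht hz
  exact ⟨⟨1 - a, z, this ▸ ht, hz⟩, rfl⟩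

theorem ring_jacobson_eq : Ring.jacobson A = (⊥ : Ideal A).jacobson := by
  rw [Ring.jacobson_eq_sInf_isMaximal, Ideal.jacobson]
  simp

/-- A row vector fixed by a square matrix with entries in the Jacobson radical is zero. -/
theorem eq_zero_of_vecMul_eq_self {n : Type w} [Fintype n] (a : Matrix n n A)
    (ha : ∀ i j, a i j ∈ Ring.jacobson A) (r : n → A) (hr : ∀ j, r j = ∑ i, r i * a i j) :
    r = 0 := by
  classical
  -- Matrices over the radical lie in the radical of the matrix ring, so `1 - a` is invertible.
  have h1 : a ∈ (⊥ : Ideal (Matrix n n A)).jacobson := by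
    have := Ideal.matrix_jacobson_le (n := n) (⊥ : Ideal A)
    rw [Ideal.matrix_bot] at this
    exact this fun i j => ring_jacobson_eq (A := A) ▸ ha i j
  obtain ⟨b, hb, -⟩ := (isUnit_iff_exists.1 (isUnit_one_sub_of_mem_jacobson h1))
  have h2 : Matrix.vecMul r (1 - a) = 0 := by
    rw [Matrix.vecMul_sub, Matrix.vecMul_one, sub_eq_zero]
    ext j
    exact hr j
  calc r = Matrix.vecMul r ((1 - a) * b) := by rw [hb, Matrix.vecMul_one]
    _ = 0 := by rw [← Matrix.vecMul_vecMul, h2, Matrix.zero_vecMul]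

/-- Bass: a projective module that equals its radical is zero. -/
theorem subsingleton_of_projective_of_jacobson_eq_top {Q : Type x} [AddCommGroup Q] [Module A Q]
    [Module.Projective A Q] (hQ : Module.jacobson A Q = ⊤) : Subsingleton Q := by
  classical
  obtain ⟨i, hi⟩ := Module.projective_def'.1 (inferInstance : Module.Projective A Q)
  have hi' : ∀ q, Finsupp.linearCombination A id (i q) = q := fun q => LinearMap.congr_fun hi q
  have hJ : ∀ q j, i q j ∈ Ring.jacobson A := fun q j =>
    Module.le_comap_jacobson (f := (Finsupp.lapply j : (Q →₀ A) →ₗ[A] A) ∘ₗ i)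
      (hQ ▸ Submodule.mem_top : q ∈ Module.jacobson A Q)
  refine subsingleton_of_forall_eq 0 fun q => ?_
  -- Applying `i` to the expansion of `q` in its own coordinates gives a fixed row vector.
  -- Restricting to the finite support of `i q` makes the matrix square, and its entries are radical
  -- because `Q` is its own radical.
  have hx : ∀ j, i q j = ∑ t : (i q).support, i q t * i t j := by
    intro j
    have h1 := congrArg i (hi' q)
    rw [Finsupp.linearCombination_apply, Finsupp.sum, map_sum] at h1
    have h2 := DFunLike.congr_fun h1 j
    rw [← h2, Finsupp.finsetSum_apply,
      ← Finset.sum_coe_sort (i q).support]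
    simp
  have h0 : (fun j : (i q).support => i q j) = 0 :=
    eq_zero_of_vecMul_eq_self (fun s t : (i q).support => i s t) (fun s t => hJ _ _) _
      fun j => hx j
  have h3 : i q = 0 := by
    ext j
    by_contra hj
    exact hj (congrFun h0 ⟨j, Finsupp.mem_support_iff.2 hj⟩)
  rw [← hi' q, h3, map_zero]

/-- Projective covers of the same module are isomorphic, if one of them is finitely generated. -/
theorem IsProjectiveCover.nonempty_linearEquiv {P : Type x} {P' : Type v} {M : Type w}
    [AddCommGroup P] [Module A P] [AddCommGroup P'] [Module A P'] [AddCommGroup M] [Module A M]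
    [Module.Finite A P'] {π : P →ₗ[A] M} {π' : P' →ₗ[A] M}
    (h : IsProjectiveCover π) (h' : IsProjectiveCover π') : Nonempty (P ≃ₗ[A] P') := by
  obtain ⟨hP, hs, hk⟩ := h
  obtain ⟨hP', hs', hk'⟩ := h'
  obtain ⟨f, hf⟩ := Module.projective_lifting_property π' π hs'
  have hf' : ∀ q, π' (f q) = π q := LinearMap.congr_fun hf
  -- Nakayama: the range of `f` and the kernel of `π'` together span `P'`, and that kernel lies in
  -- every maximal submodule. Finiteness of `P'` puts a proper range inside a maximal submodule.
  have hfs : LinearMap.range f = ⊤ := by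
    by_contra hne
    obtain ⟨N, hN, hle⟩ := (eq_top_or_exists_le_coatom (LinearMap.range f)).resolve_left hne
    refine hN.1 (top_le_iff.1 fun q _ => ?_)
    obtain ⟨r, hr⟩ := hs (π' q)
    have h1 : q - f r ∈ N := (Submodule.mem_sInf.1 (hk' (by
      rw [LinearMap.mem_ker, map_sub, hf', hr, sub_self]))) N hN
    simpa using add_mem h1 (hle ⟨r, rfl⟩)
  obtain ⟨g, hg⟩ := Module.projective_lifting_property f LinearMap.id (LinearMap.range_eq_top.1 hfs)
  have hg' : ∀ q, f (g q) = q := LinearMap.congr_fun hg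
  let e : P →ₗ[A] LinearMap.ker f :=
    (LinearMap.id - g ∘ₗ f).codRestrict _ fun q => by simp [hg']
  have he : e ∘ₗ (LinearMap.ker f).subtype = LinearMap.id := by
    ext q
    have : f q = 0 := q.2
    simp [e, this]
  have : Module.Projective A (LinearMap.ker f) := Module.Projective.of_split _ e he
  -- The retraction `e` carries radical elements of `P` to radical elements of the summand.
  have hrad : Module.jacobson A (LinearMap.ker f) = ⊤ := by
    refine top_le_iff.1 fun q _ => ?_
    have h1 : (q : P) ∈ Module.jacobson A P := hk (by
      rw [LinearMap.mem_ker, ← hf', show f q = 0 from q.2, map_zero])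
    have h2 := Module.le_comap_jacobson (f := e) h1
    rwa [Submodule.mem_comap, show e q = q from LinearMap.congr_fun he q] at h2
  have hsub := subsingleton_of_projective_of_jacobson_eq_top hrad
  exact ⟨LinearEquiv.ofBijective f ⟨LinearMap.ker_eq_bot.1
    ((Submodule.subsingleton_iff_eq_bot).1 hsub), LinearMap.range_eq_top.1 hfs⟩⟩

end ProjectiveCovers

/-! ### Idempotents and `p`-semilinear maps -/

section FrobeniusFixedElements

/-- Commuting elements `y t` of an algebra, indexed by a finite-dimensional space spanned by the
values of a map `φ` with `y (φ t) = (y t) ^ p`, are annihilated by a complementary idempotent. -/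
theorem exists_annihilating_idempotent {p : ℕ} (hp : 2 ≤ p) {F : Type u} [Field F]
    {T : Type v} [AddCommGroup T] [Module F T] [Module.Finite F T] {B : Type w} [Ring B]
    [Algebra F B] (y : T →ₗ[F] B) (hy : ∀ s t, y s * y t = y t * y s) (φ : T → T)
    (hφ : ∀ t, y (φ t) = y t ^ p) (hspan : Submodule.span F (Set.range φ) = ⊤) :
    ∃ e : B, (∀ t, y t * e = 0) ∧ 1 - e ∈ NonUnitalAlgebra.adjoin F (Set.range y) := by
  have hcomm : ∀ a ∈ Set.range y, ∀ b ∈ Set.range y, a * b = b * a := by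
    rintro _ ⟨s, rfl⟩ _ ⟨t, rfl⟩
    exact hy s t
  have hC := Algebra.isMulCommutative_adjoin F hcomm
  let _ : CommRing (Algebra.adjoin F (Set.range y)) :=
    { (inferInstance : Ring (Algebra.adjoin F (Set.range y))) with
      mul_comm := hC.is_comm.comm }
  let z : T →ₗ[F] Algebra.adjoin F (Set.range y) :=
    y.codRestrict (Subalgebra.toSubmodule (Algebra.adjoin F (Set.range y)))
      fun t => Algebra.subset_adjoin ⟨t, rfl⟩
  have hz : ∀ t, z (φ t) = z t ^ p := fun t => Subtype.ext (hφ t)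
  let I : Ideal (Algebra.adjoin F (Set.range y)) := Ideal.span (Set.range z)
  obtain ⟨s, hs⟩ : (⊤ : Submodule F T).FG := Module.Finite.fg_top
  have hIz : ∀ (J : Ideal (Algebra.adjoin F (Set.range y))) (S : Set T),
      Submodule.span F S = ⊤ → (∀ t ∈ S, z t ∈ J) → I ≤ J := by
    intro J S hS h
    refine Ideal.span_le.2 ?_
    rintro _ ⟨t, rfl⟩
    have ht : t ∈ Submodule.span F S := hS ▸ Submodule.mem_top
    induction ht using Submodule.span_induction with
    | mem t ht => exact h t ht
    | zero => simp
    | add a b _ _ ha hb => simpa using add_mem ha hb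
    | smul c a _ ha =>
      rw [map_smul, Algebra.smul_def]
      exact Ideal.mul_mem_left _ _ ha
  have hfg : I.FG := by
    classical
    refine ⟨s.image z, le_antisymm ?_ (hIz _ s hs fun t ht => Ideal.subset_span ?_)⟩
    · refine Ideal.span_mono ?_
      simp
    · simpa using ⟨t, ht, rfl⟩
  -- `I` is generated by the `p`-th powers `z (φ t)`, which lie in `I * I` because `p ≥ 2`.
  have hidem : IsIdempotentElem I := by
    refine le_antisymm Ideal.mul_le_left (hIz _ _ hspan ?_)
    rintro _ ⟨t, rfl⟩
    have hzt : z t ∈ I := Ideal.subset_span ⟨t, rfl⟩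
    rw [hz, show p = (p - 1) + 1 by omega, pow_succ]
    exact Ideal.mul_mem_mul (Ideal.pow_mem_of_mem _ hzt _ (by omega)) hzt
  obtain ⟨f, hf, hIf⟩ := (Ideal.isIdempotentElem_iff_of_fg I hfg).1 hidem
  refine ⟨1 - f, fun t => ?_, ?_⟩
  · have hzt : z t ∈ I := Ideal.subset_span ⟨t, rfl⟩
    rw [hIf] at hzt
    obtain ⟨c, hc⟩ := Submodule.mem_span_singleton.1 hzt
    have h1 : z t * (1 - f) = 0 := by
      rw [← hc, smul_eq_mul, mul_assoc, mul_sub, mul_one, hf.eq, sub_self, mul_zero]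
    exact congrArg Subtype.val h1
  -- The nonunital algebra generated by the `y t` is stable under multiplication by the unital one,
  -- so it contains the ideal `I`, and `f` with it.
  · have hmul : ∀ c ∈ Algebra.adjoin F (Set.range y),
        ∀ b ∈ NonUnitalAlgebra.adjoin F (Set.range y),
          c * b ∈ NonUnitalAlgebra.adjoin F (Set.range y) := by
      intro c hc
      induction hc using Algebra.adjoin_induction with
      | mem c hc => exact fun b hb => mul_mem (NonUnitalAlgebra.subset_adjoin F hc) hb
      | algebraMap r =>
        intro b hb
        rw [← Algebra.smul_def]
        exact SMulMemClass.smul_mem r hb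
      | add c d _ _ hc hd => exact fun b hb => by simpa [add_mul] using add_mem (hc b hb) (hd b hb)
      | mul c d _ _ hc hd => exact fun b hb => by simpa [mul_assoc] using hc _ (hd b hb)
    have hfI : f ∈ I := hIf ▸ Submodule.mem_span_singleton_self f
    rw [sub_sub_cancel]
    clear hIf hf
    induction hfI using Submodule.span_induction with
    | mem c hc =>
      obtain ⟨t, rfl⟩ := hc
      exact NonUnitalAlgebra.subset_adjoin F ⟨t, rfl⟩
    | zero => exact zero_mem _
    | add a b _ _ ha hb => exact add_mem ha hb
    | smul c a _ ha => exact hmul c c.2 _ ha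

variable {F : Type u} [Field F] {V : Type v} [AddCommGroup V] [Module F V] {p : ℕ} {φ : V → V}
  {W : Submodule F V}

/-- Semilinearity is required only on `W`, since the `p`-map is additive on commuting elements but
not in general. Spans of images appear because `F` need not be perfect, so an image need not be a
subspace. -/
theorem span_image_sup_le (hadd : ∀ a ∈ W, ∀ b ∈ W, φ (a + b) = φ a + φ b) {U U' : Submodule F V}
    (hU : U ≤ W) (hU' : U' ≤ W) :
    Submodule.span F (φ '' (U ⊔ U' : Submodule F V)) ≤
      Submodule.span F (φ '' U) ⊔ Submodule.span F (φ '' U') := by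
  rw [Submodule.span_le]
  rintro _ ⟨a, ha, rfl⟩
  obtain ⟨b, hb, c, hc, rfl⟩ := Submodule.mem_sup.1 ha
  rw [hadd b (hU hb) c (hU' hc)]
  exact Submodule.add_mem_sup (Submodule.subset_span ⟨b, hb, rfl⟩)
    (Submodule.subset_span ⟨c, hc, rfl⟩)

theorem mem_of_mem_span_of_semilinear (hadd : ∀ a ∈ W, ∀ b ∈ W, φ (a + b) = φ a + φ b)
    (hsmul : ∀ (c : F), ∀ a ∈ W, φ (c • a) = c ^ p • φ a) {S : Set V} {U : Submodule F V}
    (hS : S ⊆ W) (h : ∀ a ∈ S, φ a ∈ U) {a : V} (ha : a ∈ Submodule.span F S) : φ a ∈ U := by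
  have hSW : Submodule.span F S ≤ W := Submodule.span_le.2 hS
  induction ha using Submodule.span_induction with
  | mem a ha => exact h a ha
  | zero =>
    have h0 := hadd 0 W.zero_mem 0 W.zero_mem
    rw [add_zero, left_eq_add] at h0
    rw [h0]
    exact U.zero_mem
  | add a b ha hb h1 h2 =>
    rw [hadd a (hSW ha) b (hSW hb)]
    exact add_mem h1 h2
  | smul c a ha h1 =>
    rw [hsmul c a (hSW ha)]
    exact U.smul_mem _ h1

/-- The images of a basis of `U` already span. -/
theorem finrank_span_image_le [Module.Finite F V]
    (hadd : ∀ a ∈ W, ∀ b ∈ W, φ (a + b) = φ a + φ b)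
    (hsmul : ∀ (c : F), ∀ a ∈ W, φ (c • a) = c ^ p • φ a) {U : Submodule F V} (hU : U ≤ W) :
    Module.finrank F (Submodule.span F (φ '' U)) ≤ Module.finrank F U := by
  let b := Module.finBasis F U
  have hb : Submodule.span F (Set.range fun i => (b i : V)) = U := by
    have h1 := congrArg (Submodule.map U.subtype) b.span_eq
    rw [Submodule.map_span, Submodule.map_top, Submodule.range_subtype, ← Set.range_comp] at h1
    exact h1
  have h2 : Submodule.span F (φ '' U) ≤ Submodule.span F (Set.range fun i => φ (b i)) := by
    rw [Submodule.span_le]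
    rintro _ ⟨a, ha, rfl⟩
    refine mem_of_mem_span_of_semilinear hadd hsmul (S := Set.range fun i => (b i : V)) ?_ ?_
      (hb.symm ▸ ha : a ∈ Submodule.span F (Set.range fun i => (b i : V)))
    · rintro _ ⟨i, rfl⟩
      exact hU (b i).2
    · rintro _ ⟨i, rfl⟩
      exact Submodule.subset_span ⟨i, rfl⟩
  calc _ ≤ Module.finrank F (Submodule.span F (Set.range fun i => φ (b i))) :=
        Submodule.finrank_mono h2
    _ ≤ Fintype.card (Fin (Module.finrank F U)) := finrank_range_le_card _
    _ = _ := Fintype.card_fin _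

/-- If a finite-dimensional space `W` is spanned by the image of a `p`-semilinear map `φ`, every
element `a` of `W` lies in the span of the iterates `φ^[i] a` with `i ≥ 1`. -/
theorem mem_span_iterates_of_span_image_eq [Module.Finite F V]
    (hadd : ∀ a ∈ W, ∀ b ∈ W, φ (a + b) = φ a + φ b)
    (hsmul : ∀ (c : F), ∀ a ∈ W, φ (c • a) = c ^ p • φ a)
    (hW : ∀ a ∈ W, φ a ∈ W) (hspan : W ≤ Submodule.span F (φ '' W)) {a : V} (ha : a ∈ W) :
    a ∈ Submodule.span F (Set.range fun i : ℕ => φ^[i + 1] a) := by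
  have hit : ∀ i, φ^[i] a ∈ W := fun i => by
    induction i with
    | zero => exact ha
    | succ i ih => rw [Function.iterate_succ_apply']; exact hW _ ih
  obtain ⟨U, hU⟩ : ∃ U, U = Submodule.span F (Set.range fun i : ℕ => φ^[i] a) := ⟨_, rfl⟩
  have hUW : U ≤ W := hU ▸ Submodule.span_le.2 (by rintro _ ⟨i, rfl⟩; exact hit i)
  have h1 : Submodule.span F (φ '' U) ≤ Submodule.span F (Set.range fun i : ℕ => φ^[i + 1] a) := by
    rw [Submodule.span_le]
    rintro _ ⟨b, hb, rfl⟩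
    refine mem_of_mem_span_of_semilinear hadd hsmul (S := Set.range fun i : ℕ => φ^[i] a) ?_ ?_
      (hU ▸ hb)
    · rintro _ ⟨i, rfl⟩
      exact hit i
    · rintro _ ⟨i, rfl⟩
      refine Submodule.subset_span ⟨i, ?_⟩
      exact Function.iterate_succ_apply' φ i a
  have h2 : Submodule.span F (Set.range fun i : ℕ => φ^[i + 1] a) ≤ U := hU ▸
    Submodule.span_mono (by rintro _ ⟨i, rfl⟩; exact ⟨i + 1, rfl⟩)
  obtain ⟨U', hU'⟩ := Submodule.exists_isCompl (U.comap W.subtype)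
  have hsup : U ⊔ U'.map W.subtype = W := by
    have h3 := congrArg (Submodule.map W.subtype) hU'.sup_eq_top
    rwa [Submodule.map_sup, Submodule.map_top, Submodule.range_subtype,
      Submodule.map_comap_subtype, inf_eq_right.2 hUW] at h3
  have hU'W : U'.map W.subtype ≤ W := Submodule.map_subtype_le W U'
  have hdim : Module.finrank F U + Module.finrank F (U'.map W.subtype) ≤ Module.finrank F W := by
    have h4 := Submodule.finrank_sup_add_finrank_inf_eq U (U'.map W.subtype)
    have h5 : U ⊓ U'.map W.subtype = ⊥ := by
      rw [eq_bot_iff]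
      rintro _ ⟨hb, ⟨c, hc, rfl⟩⟩
      have h6 : c ∈ U.comap W.subtype ⊓ U' := ⟨hb, hc⟩
      rw [hU'.inf_eq_bot, Submodule.mem_bot] at h6
      simp [h6]
    rw [h5, hsup, finrank_bot] at h4
    omega
  -- Dimension count: `U'` contributes at most its own dimension to the image, so the image of `U`
  -- must span at least `dim U` dimensions. It lies in the span of the later iterates, a subspace of
  -- `U`, which is therefore all of `U`.
  have h7 : Module.finrank F W ≤ Module.finrank F (Submodule.span F (φ '' U)) +
      Module.finrank F (Submodule.span F (φ '' (U'.map W.subtype : Submodule F V))) := by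
    refine (Submodule.finrank_mono ?_).trans (Submodule.finrank_add_le_finrank_add_finrank _ _)
    refine hspan.trans ?_
    conv_lhs => rw [← hsup]
    exact span_image_sup_le hadd hUW hU'W
  have h8 := finrank_span_image_le hadd hsmul hU'W
  have h9 : Submodule.span F (Set.range fun i : ℕ => φ^[i + 1] a) = U := by
    refine Submodule.eq_of_le_of_finrank_le h2 ?_
    have := Submodule.finrank_mono h1
    omega
  rw [h9, hU]
  exact Submodule.subset_span ⟨0, rfl⟩

/-- Some iterate `φ^[k] a` lies in the span of the later iterates. -/
theorem exists_iterate_mem_span_iterates [Module.Finite F V] (φ : V → V) (a : V) :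
    ∃ k, φ^[k] a ∈ Submodule.span F (Set.range fun i : ℕ => φ^[i + 1] (φ^[k] a)) := by
  -- The spans of the tails of the orbit form a descending chain, which stabilizes.
  let f : ℕ →o (Submodule F V)ᵒᵈ :=
    ⟨fun k => OrderDual.toDual (Submodule.span F (Set.range fun i : ℕ => φ^[i + k] a)), by
      intro k l hkl
      refine OrderDual.toDual_le_toDual.2 (Submodule.span_mono ?_)
      rintro _ ⟨i, rfl⟩
      refine ⟨i + (l - k), ?_⟩
      change φ^[_] a = φ^[_] a
      congr 1
      omega⟩
  obtain ⟨k, hk⟩ := IsArtinian.monotone_stabilizes f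
  refine ⟨k, ?_⟩
  have h1 : Submodule.span F (Set.range fun i : ℕ => φ^[i + k] a) =
      Submodule.span F (Set.range fun i : ℕ => φ^[i + (k + 1)] a) := hk (k + 1) (by omega)
  have h2 : (fun i : ℕ => φ^[i + 1] (φ^[k] a)) = fun i : ℕ => φ^[i + (k + 1)] a := by
    funext i
    rw [← Function.iterate_add_apply]
    congr 1
    omega
  rw [h2, ← h1]
  exact Submodule.subset_span ⟨0, by simp⟩

end FrobeniusFixedElements

/-! ### Tori and their centralizers -/

section Tori

variable {p : ℕ} {F : Type u} {L : Type v} [Field F] [LieRing L] [LieAlgebra F L]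
  [RestrictedLieAlgebra p F L]

theorem pMap_lie (a b : L) : ⁅pMap p F a, b⁆ = ((LieAlgebra.ad F L a) ^ p) b := by
  rw [← RestrictedLieAlgebra.ad_pMap a]
  rfl

theorem pMap_lie_eq_zero (hp : 2 ≤ p) {a b : L} (h : ⁅a, b⁆ = 0) : ⁅pMap p F a, b⁆ = 0 := by
  rw [pMap_lie, show p = (p - 1) + 1 by omega, pow_succ, Module.End.mul_apply,
    LieAlgebra.ad_apply, h, map_zero]

theorem iterate_pMap_lie_eq_zero (hp : 2 ≤ p) {a b : L} (h : ⁅a, b⁆ = 0) (i : ℕ) :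
    ⁅(pMap p F)^[i] a, b⁆ = 0 := by
  induction i with
  | zero => exact h
  | succ i ih =>
    rw [Function.iterate_succ_apply']
    exact pMap_lie_eq_zero hp ih

/-- In each Jacobson term the factor applied first sends `a` to `[a, a] X + [b, a] = 0`. -/
theorem pMap_add_of_lie_eq_zero (hp : 2 ≤ p) {a b : L} (h : ⁅a, b⁆ = 0) :
    pMap p F (a + b) = pMap p F a + pMap p F b := by
  have hba : ⁅b, a⁆ = 0 := by rw [← lie_skew, h, neg_zero]
  refine (RestrictedLieAlgebra.pMap_add (p := p) (F := F) a b).trans ?_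
  rw [Finset.sum_eq_zero, add_zero]
  · rfl
  intro i _
  rw [jacobsonTerm, show p - 1 = (p - 2) + 1 by omega, pow_succ, mul_add, ← mul_assoc]
  cases i - 1 with
  | zero => simp [Polynomial.mul_coeff_zero, hba]
  | succ n => simp [hba]

theorem lie_eq_zero_of_mem_span {S : Set L} {b : L} (h : ∀ a ∈ S, ⁅a, b⁆ = 0) {a : L}
    (ha : a ∈ Submodule.span F S) : ⁅a, b⁆ = 0 := by
  induction ha using Submodule.span_induction with
  | mem a ha => exact h a ha
  | zero => exact zero_lie b
  | add c d _ _ hc hd => rw [add_lie, hc, hd, add_zero]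
  | smul c a _ ha => rw [smul_lie, ha, smul_zero]

/-- A maximal torus contains the semisimple elements of its centralizer. -/
theorem PSubalgebra.IsMaximalTorus.mem_of_isPSemisimple (hp : 2 ≤ p) [Module.Finite F L]
    {T : PSubalgebra p F L} (hT : T.IsMaximalTorus) {s : L} (hs : IsPSemisimple p F s)
    (hsT : ∀ t ∈ T.toLieSubalgebra, ⁅s, t⁆ = 0) : s ∈ T.toLieSubalgebra := by
  -- The span of `T` and the orbit of `s` will be a torus, so by maximality it is no larger than
  -- `T`.
  let G : Set L := (T.toLieSubalgebra : Set L) ∪ Set.range fun i : ℕ => (pMap p F)^[i] s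
  have hss : ∀ i, ⁅s, (pMap p F)^[i] s⁆ = 0 := fun i => by
    rw [← lie_skew, iterate_pMap_lie_eq_zero hp (lie_self s), neg_zero]
  have hG : ∀ a ∈ G, ∀ b ∈ G, ⁅a, b⁆ = 0 := by
    rintro a (ha | ⟨i, rfl⟩) b (hb | ⟨j, rfl⟩)
    · have := hT.1.1
      exact congrArg Subtype.val
        (trivial_lie_zero T.toLieSubalgebra T.toLieSubalgebra ⟨a, ha⟩ ⟨b, hb⟩)
    · change ⁅a, (pMap p F)^[j] s⁆ = 0
      rw [← lie_skew, iterate_pMap_lie_eq_zero hp (hsT a ha), neg_zero]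
    · exact iterate_pMap_lie_eq_zero hp (hsT b hb) i
    · exact iterate_pMap_lie_eq_zero hp (hss j) i
  obtain ⟨W, hW⟩ : ∃ W, W = Submodule.span F G := ⟨_, rfl⟩
  have hGW : G ⊆ W := hW ▸ Submodule.subset_span
  have hab : ∀ a ∈ W, ∀ b ∈ W, ⁅a, b⁆ = 0 := by
    intro a ha b hb
    rw [hW] at ha hb
    refine lie_eq_zero_of_mem_span (fun c hc => ?_) ha
    rw [← lie_skew, lie_eq_zero_of_mem_span (fun d hd => hG d hd c hc) hb, neg_zero]
  have hadd : ∀ a ∈ W, ∀ b ∈ W, pMap p F (a + b) = pMap p F a + pMap p F b := fun a ha b hb =>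
    pMap_add_of_lie_eq_zero hp (hab a ha b hb)
  have hsmul : ∀ (c : F), ∀ a ∈ W, pMap p F (c • a) = c ^ p • pMap p F a := fun c a _ =>
    RestrictedLieAlgebra.pMap_smul c a
  have hGφ : ∀ a ∈ G, pMap p F a ∈ G := by
    rintro a (ha | ⟨i, rfl⟩)
    · exact Or.inl (T.pMap_mem ha)
    · exact Or.inr ⟨i + 1, Function.iterate_succ_apply' _ _ _⟩
  have hWφ : ∀ a ∈ W, pMap p F a ∈ W := fun a ha =>
    mem_of_mem_span_of_semilinear hadd hsmul hGW (fun b hb => hGW (hGφ b hb)) (hW ▸ ha)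
  have hGit : ∀ a ∈ G, ∀ i, (pMap p F)^[i] a ∈ G := by
    intro a ha i
    induction i with
    | zero => exact ha
    | succ i ih => rw [Function.iterate_succ_apply']; exact hGφ _ ih
  have hsG : s ∈ G := Or.inr ⟨0, rfl⟩
  have hsemi : ∀ a ∈ G, IsPSemisimple p F a →
      a ∈ Submodule.span F (pMap p F '' (W : Set L)) := by
    intro a ha h
    refine Submodule.span_mono ?_ h
    rintro _ ⟨i, rfl⟩
    exact ⟨_, hGW (hGit a ha i), (Function.iterate_succ_apply' _ _ _).symm⟩
  -- Elements of `T` and `s` itself are covered by semisimplicity; later iterates of `s` are `p`-th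
  -- powers outright. Every element of `W` is then semisimple by the dimension count above.
  have hspan : W ≤ Submodule.span F (pMap p F '' (W : Set L)) := by
    conv_lhs => rw [hW]
    rw [Submodule.span_le]
    rintro a (ha | ⟨i, rfl⟩)
    · exact hsemi a (Or.inl ha) (hT.1.2 a ha)
    · cases i with
      | zero => exact hsemi s hsG hs
      | succ i =>
        exact Submodule.subset_span
          ⟨_, hGW (hGit s hsG i), (Function.iterate_succ_apply' _ _ _).symm⟩
  let T' : PSubalgebra p F L :=
    { W with
      lie_mem' := fun {a b} ha hb => by
        change ⁅a, b⁆ ∈ W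
        rw [hab a ha b hb]
        exact W.zero_mem
      pMap_mem := fun {a} ha => hWφ a ha }
  have hT' : T'.IsTorus :=
    ⟨⟨fun a b => Subtype.ext (hab a a.2 b b.2)⟩, fun a ha =>
      mem_span_iterates_of_span_image_eq hadd hsmul hWφ hspan ha⟩
  exact hT.2 T' hT' (fun t ht => hGW (Or.inl ht)) (hGW hsG)

/-- Semisimplicity writes `t` in terms of `t^[p]^i` with `i ≥ 1`, each the `p`-th power of an
element of `T`. This supplies the spanning hypothesis of `exists_annihilating_idempotent`. -/
theorem PSubalgebra.IsTorus.span_range_pMap {T : PSubalgebra p F L} (hT : T.IsTorus) :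
    Submodule.span F (Set.range (pMap p F : T.toLieSubalgebra → T.toLieSubalgebra)) = ⊤ := by
  refine top_le_iff.1 fun t _ => ?_
  have hit : ∀ i, (pMap p F)^[i] (t : L) ∈ T.toLieSubalgebra := fun i => by
    induction i with
    | zero => exact t.2
    | succ i ih => rw [Function.iterate_succ_apply']; exact T.pMap_mem ih
  have h1 : (t : L) ∈ (Submodule.span F
      (Set.range (pMap p F : T.toLieSubalgebra → T.toLieSubalgebra))).map
        T.toLieSubalgebra.toSubmodule.subtype := by
    rw [Submodule.map_span]
    refine Submodule.span_mono ?_ (hT.2 t t.2)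
    rintro _ ⟨i, rfl⟩
    exact ⟨_, ⟨⟨_, hit i⟩, rfl⟩, (Function.iterate_succ_apply' (pMap p F) i (t : L)).symm⟩
  obtain ⟨t', ht', h2⟩ := h1
  rwa [← show t' = t from Subtype.ext h2]

end Tori

/-! ### Irreducible restricted representations with torus invariants -/

section RestrictedRepresentations

/-- Take the last nonzero vector in the sequence of iterates. -/
theorem exists_pow_apply_ne_zero_of_pow_apply_eq_zero {R : Type u} [Semiring R] {M : Type w}
    [AddCommMonoid M] [Module R M] {f : Module.End R M} {n : ℕ} {m : M} (hm : m ≠ 0)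
    (h : (f ^ n) m = 0) : ∃ j, (f ^ j) m ≠ 0 ∧ f ((f ^ j) m) = 0 := by
  induction n with
  | zero => exact absurd h hm
  | succ n ih =>
    by_cases h' : (f ^ n) m = 0
    · exact ih h'
    · exact ⟨n, h', by rwa [pow_succ'] at h⟩

/-- Finitely many commuting nilpotent operators have a common kernel vector. -/
theorem exists_ne_zero_forall_apply_eq_zero {R : Type u} [Semiring R] {M : Type w}
    [AddCommMonoid M] [Module R M] [Nontrivial M] (s : Finset (Module.End R M))
    (hs : ∀ f ∈ s, ∀ g ∈ s, f * g = g * f) (hnil : ∀ f ∈ s, IsNilpotent f) :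
    ∃ m : M, m ≠ 0 ∧ ∀ f ∈ s, f m = 0 := by
  classical
  induction s using Finset.induction_on with
  | empty => simpa using exists_ne (0 : M)
  | insert f s _ ih =>
    obtain ⟨m, hm, h⟩ := ih
      (fun g hg k hk => hs g (Finset.mem_insert_of_mem hg) k (Finset.mem_insert_of_mem hk))
      fun g hg => hnil g (Finset.mem_insert_of_mem hg)
    obtain ⟨n, hn⟩ := hnil f (Finset.mem_insert_self f s)
    obtain ⟨j, hj, hj'⟩ := exists_pow_apply_ne_zero_of_pow_apply_eq_zero hm
      (show (f ^ n) m = 0 by rw [hn]; rfl)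
    refine ⟨_, hj, fun g hg => ?_⟩
    rcases Finset.mem_insert.1 hg with rfl | hg'
    · exact hj'
    · have hc : Commute g f := hs g hg f (Finset.mem_insert_self f s)
      rw [← Module.End.mul_apply, (hc.pow_right j).eq, Module.End.mul_apply, h g hg', map_zero]

variable {p : ℕ} {F : Type u} {L : Type v} [Field F] [LieRing L] [LieAlgebra F L]
  {M : Type w} [AddCommGroup M] [Module F M] {ρ : L →ₗ[F] Module.End F M}

/-- Schur: the kernel of `f` is a nonzero subrepresentation. -/
theorem eq_zero_of_commute_of_apply_eq_zero
    (hirr : ∀ N : Submodule F M, (∀ a, ∀ m ∈ N, ρ a m ∈ N) → N = ⊥ ∨ N = ⊤)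
    {f : Module.End F M} (hf : ∀ a, f * ρ a = ρ a * f) {m : M} (hm : m ≠ 0) (hfm : f m = 0) :
    f = 0 := by
  rcases hirr (LinearMap.ker f) (fun a n hn => by
    rw [LinearMap.mem_ker] at hn ⊢
    rw [← Module.End.mul_apply, hf, Module.End.mul_apply, hn, map_zero]) with h | h
  · exact absurd ((Submodule.eq_bot_iff _).1 h m hfm) hm
  · exact LinearMap.ker_eq_top.1 h

variable [RestrictedLieAlgebra p F L]

theorem map_iterate_pMap (hρp : ∀ a, ρ (pMap p F a) = ρ a ^ p) (k : ℕ) (a : L) :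
    ρ ((pMap p F)^[k] a) = ρ a ^ p ^ k := by
  induction k with
  | zero => simp
  | succ k ih => rw [Function.iterate_succ_apply', hρp, ih, ← pow_mul, pow_succ]

/-- Elements that are central modulo the kernel of an irreducible restricted representation with
nonzero invariants under a maximal torus lie in the kernel. -/
theorem map_eq_zero_of_forall_map_lie_eq_zero (hp : 2 ≤ p) [Module.Finite F L]
    (hρ : ∀ a b : L, ρ ⁅a, b⁆ = ρ a * ρ b - ρ b * ρ a) (hρp : ∀ a, ρ (pMap p F a) = ρ a ^ p)
    (hirr : ∀ N : Submodule F M, (∀ a, ∀ m ∈ N, ρ a m ∈ N) → N = ⊥ ∨ N = ⊤)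
    {T : PSubalgebra p F L} (hT : T.IsMaximalTorus) {m : M} (hm : m ≠ 0)
    (hTm : ∀ t ∈ T.toLieSubalgebra, ρ t m = 0) {z : L} (hz : ∀ a : L, ρ ⁅a, z⁆ = 0) : ρ z = 0 := by
  have hcomm : ∀ a, ρ z * ρ a = ρ a * ρ z := fun a => by
    have := hz a
    rw [hρ, sub_eq_zero] at this
    exact this.symm
  have hTab : ∀ s t : T.toLieSubalgebra, ⁅(s : L), (t : L)⁆ = 0 := fun s t => by
    have := hT.1.1
    exact congrArg Subtype.val (trivial_lie_zero T.toLieSubalgebra T.toLieSubalgebra s t)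
  -- For the adjoint action of `T`, the operator `e` maps `L` into the centralizer of `T`.
  obtain ⟨e, he, he'⟩ := exists_annihilating_idempotent hp
    ((LieAlgebra.ad F L : L →ₗ[F] Module.End F L) ∘ₗ T.toLieSubalgebra.toSubmodule.subtype)
    (fun s t => by
      rw [← sub_eq_zero]
      ext a
      have := lie_lie (s : L) (t : L) a
      rw [hTab, zero_lie] at this
      exact this.symm)
    (pMap p F : T.toLieSubalgebra → T.toLieSubalgebra)
    (fun t => RestrictedLieAlgebra.ad_pMap (t : L)) hT.1.span_range_pMap
  -- `1 - e` is a polynomial without constant term in the operators `ad t`, each of which sends `z`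
  -- into `ker ρ`. The first clause, stability of `ker ρ`, is what lets the induction pass through
  -- products.
  have hker : (∀ a, ρ a = 0 → ρ ((1 - e) a) = 0) ∧ ρ ((1 - e) z) = 0 := by
    generalize 1 - e = g at he'
    induction he' using NonUnitalAlgebra.adjoin_induction with
    | mem f hf =>
      obtain ⟨t, rfl⟩ := hf
      refine ⟨fun a ha => ?_, hz t⟩
      change ρ ⁅(t : L), a⁆ = 0
      rw [hρ, ha, mul_zero, zero_mul, sub_zero]
    | add f g _ _ hf hg =>
      refine ⟨fun a ha => ?_, ?_⟩
      · rw [LinearMap.add_apply, map_add, hf.1 a ha, hg.1 a ha, add_zero]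
      · rw [LinearMap.add_apply, map_add, hf.2, hg.2, add_zero]
    | zero => simp
    | mul f g _ _ hf hg => exact ⟨fun a ha => hf.1 _ (hg.1 a ha), hf.1 _ hg.2⟩
    | smul c f _ hf =>
      refine ⟨fun a ha => ?_, ?_⟩
      · rw [LinearMap.smul_apply, map_smul, hf.1 a ha, smul_zero]
      · rw [LinearMap.smul_apply, map_smul, hf.2, smul_zero]
  have hez : ρ (e z) = ρ z := by
    have := hker.2
    rw [LinearMap.sub_apply, map_sub, sub_eq_zero] at this
    exact this.symm
  -- A high enough `p`-power of `e z` is semisimple and still centralizes `T`.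
  obtain ⟨k, hk⟩ := exists_iterate_mem_span_iterates (F := F) (pMap p F) (e z)
  have hs : (pMap p F)^[k] (e z) ∈ T.toLieSubalgebra := by
    refine hT.mem_of_isPSemisimple hp hk fun t ht => iterate_pMap_lie_eq_zero hp ?_ k
    rw [← lie_skew, neg_eq_zero]
    exact LinearMap.congr_fun (he ⟨t, ht⟩) z
  have hzk : (ρ z ^ p ^ k) m = 0 := by
    rw [← hez, ← map_iterate_pMap hρp]
    exact hTm _ hs
  obtain ⟨j, hj, hj'⟩ := exists_pow_apply_ne_zero_of_pow_apply_eq_zero hm hzk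
  exact eq_zero_of_commute_of_apply_eq_zero hirr hcomm hj hj'

/-- An irreducible restricted representation of a solvable restricted Lie algebra with nonzero
invariants under a maximal torus is trivial. -/
theorem eq_zero_of_irreducible_of_torus_invariant (hp : 2 ≤ p) [Module.Finite F L]
    [LieAlgebra.IsSolvable L]
    (hρ : ∀ a b : L, ρ ⁅a, b⁆ = ρ a * ρ b - ρ b * ρ a) (hρp : ∀ a, ρ (pMap p F a) = ρ a ^ p)
    (hirr : ∀ N : Submodule F M, (∀ a, ∀ m ∈ N, ρ a m ∈ N) → N = ⊥ ∨ N = ⊤)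
    {T : PSubalgebra p F L} (hT : T.IsMaximalTorus) {m : M} (hm : m ≠ 0)
    (hTm : ∀ t ∈ T.toLieSubalgebra, ρ t m = 0) : ρ = 0 := by
  classical
  have : Nontrivial M := ⟨m, 0, hm⟩
  have hideal : ∀ A : LieIdeal F L, (∀ a ∈ A, ∀ b ∈ A, ρ ⁅a, b⁆ = 0) → ∀ a ∈ A, ρ a = 0 := by
    intro A hA
    have hnil : ∀ a ∈ A, ρ a ^ p = 0 := by
      intro a ha
      rw [← hρp]
      refine map_eq_zero_of_forall_map_lie_eq_zero hp hρ hρp hirr hT hm hTm fun b => ?_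
      -- The first bracket with `a` lands in the ideal `A`, the second in `[A, A]`, which `ρ` kills;
      -- further brackets stay in `ker ρ`. Two brackets are available because `p ≥ 2`, so `a^[p]` is
      -- central modulo `ker ρ`.
      rw [← lie_skew, map_neg, neg_eq_zero, pMap_lie, show p = (p - 2) + 1 + 1 by omega]
      generalize p - 2 = n
      induction n with
      | zero =>
        rw [zero_add, pow_succ, pow_one, Module.End.mul_apply]
        exact hA a ha _ (lie_mem_left F L A a b ha)
      | succ n ih =>
        rw [pow_succ', Module.End.mul_apply, LieAlgebra.ad_apply, hρ, ih, mul_zero, zero_mul,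
          sub_zero]
    obtain ⟨s, hs⟩ : (A.toSubmodule).FG := IsNoetherian.noetherian _
    have hsA : ∀ a ∈ s, a ∈ A := fun a ha => by
      have : a ∈ A.toSubmodule := hs ▸ Submodule.subset_span ha
      exact this
    obtain ⟨v, hv, hv'⟩ := exists_ne_zero_forall_apply_eq_zero (s.image ρ)
      (by
        intro f hf g hg
        obtain ⟨a, ha, rfl⟩ := Finset.mem_image.1 hf
        obtain ⟨b, hb, rfl⟩ := Finset.mem_image.1 hg
        rw [← sub_eq_zero, ← hρ]
        exact hA a (hsA a ha) b (hsA b hb))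
      (by
        intro f hf
        obtain ⟨a, ha, rfl⟩ := Finset.mem_image.1 hf
        exact ⟨p, hnil a (hsA a ha)⟩)
    have hvA : ∀ a ∈ A, ρ a v = 0 := by
      intro a ha
      have h1 : A.toSubmodule ≤ LinearMap.ker (ρ.flip v) := by
        rw [← hs, Submodule.span_le]
        exact fun b hb => hv' _ (Finset.mem_image_of_mem ρ hb)
      exact h1 ha
    -- The common null space of `A` is a subrepresentation because `A` is an ideal, and it contains
    -- `v`.
    have hN : ⨅ a : A, LinearMap.ker (ρ a) = ⊤ := by
      refine (hirr _ fun b n hn => ?_).resolve_left fun h => hv ?_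
      · rw [Submodule.mem_iInf] at hn ⊢
        intro a
        have h1 : ρ ⁅b, (a : L)⁆ n = 0 := hn ⟨_, lie_mem_right F L A b a a.2⟩
        have h2 : ρ a n = 0 := hn a
        rw [hρ, LinearMap.sub_apply, Module.End.mul_apply, h2, map_zero, zero_sub,
          neg_eq_zero] at h1
        exact h1
      · rw [← Submodule.mem_bot F, ← h, Submodule.mem_iInf]
        exact fun a => hvA a a.2
    intro a ha
    exact LinearMap.ker_eq_top.1 (top_le_iff.1 (hN ▸ iInf_le _ (⟨a, ha⟩ : A)))
  -- If `ρ` kills one derived term, the preceding term acts by commuting operators, so `hideal`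
  -- kills it too.
  have hseries : ∀ k, (∀ a ∈ LieAlgebra.derivedSeries F L k, ρ a = 0) → ρ = 0 := by
    intro k
    induction k with
    | zero => exact fun h => LinearMap.ext fun a => h a (LieSubmodule.mem_top a)
    | succ k ih =>
      refine fun h => ih (hideal _ fun a ha b hb => h _ ?_)
      rw [LieAlgebra.derivedSeries_def, LieAlgebra.derivedSeriesOfIdeal_succ]
      exact LieSubmodule.lie_mem_lie ha hb
  obtain ⟨k, hk⟩ := LieAlgebra.IsSolvable.solvable F L
  exact hseries k fun a ha => by
    rw [hk, LieSubmodule.mem_bot] at ha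
    rw [ha, map_zero]

end RestrictedRepresentations

/-! ### Extension of scalars from a line -/

section ExtendedModules

variable {F : Type u} [Field F] {A : Type v} {B : Type w} [Ring A] [Ring B]
  [Algebra F A] [Algebra F B] (f : A →ₐ[F] B) {V : Type x} [AddCommGroup V] [Module F V]
  [Module A V]

/-- The class of `b ⊗ v` in `B ⊗_A V`. -/
def ExtendedModule.mk (b : B) (c : V) : ExtendedModule f V :=
  Submodule.Quotient.mk (b ⊗ₜ[F] c)

theorem ExtendedModule.mk_mul (b : B) (a : A) (c : V) :
    ExtendedModule.mk f (b * f a) c = ExtendedModule.mk f b (a • c) :=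
  (Submodule.Quotient.eq _).2 (Submodule.subset_span ⟨b, a, c, rfl⟩)

theorem ExtendedModule.smul_mk (b b' : B) (c : V) :
    b • ExtendedModule.mk f b' c = ExtendedModule.mk f (b * b') c :=
  rfl

variable {f} in
theorem ExtendedModule.hom_ext {N : Type*} [AddCommGroup N] [Module B N]
    {g h : ExtendedModule f V →ₗ[B] N}
    (H : ∀ b c, g (ExtendedModule.mk f b c) = h (ExtendedModule.mk f b c)) : g = h := by
  refine Submodule.linearMap_qext _ (LinearMap.ext fun t => ?_)
  induction t using TensorProduct.induction_on with
  | zero => simp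
  | tmul b c => exact H b c
  | add s t hs ht => rw [map_add, map_add, hs, ht]

variable {N : Type*} [AddCommGroup N] [Module F N] [Module B N] [IsScalarTower F B N]

/-- The `B`-linear map `B ⊗_A V → N` extending an `A`-linear map `V → N`. -/
noncomputable def ExtendedModule.lift (g : V →ₗ[F] N) (hg : ∀ a c, g (a • c) = f a • g c) :
    ExtendedModule f V →ₗ[B] N :=
  Submodule.liftQ _ (TensorProduct.AlgebraTensorModule.lift
      (LinearMap.toSpanSingleton B (V →ₗ[F] N) g)) (by
    rw [Submodule.span_le]
    rintro _ ⟨b, a, c, rfl⟩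
    simp [hg, mul_smul])

theorem ExtendedModule.lift_mk (g : V →ₗ[F] N) (hg : ∀ a c, g (a • c) = f a • g c) (b : B)
    (c : V) : ExtendedModule.lift f g hg (ExtendedModule.mk f b c) = b • g c := by
  simp [ExtendedModule.lift, ExtendedModule.mk]

/-- The module induced from a line is cyclic. -/
theorem ExtendedModule.exists_smul_mk {s : V} (ℓ : V →ₗ[F] F) (hℓ : ∀ c, ℓ c • s = c)
    (n : ExtendedModule f V) :
    ∃ b : B, b • ExtendedModule.mk f 1 s = n := by
  rw [← Submodule.mem_span_singleton]
  obtain ⟨t, rfl⟩ := Submodule.Quotient.mk_surjective _ n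
  induction t using TensorProduct.induction_on with
  | zero => exact zero_mem _
  | add a b ha hb => exact add_mem ha hb
  | tmul b c =>
    refine Submodule.mem_span_singleton.2 ⟨ℓ c • b, ?_⟩
    rw [ExtendedModule.smul_mk, mul_one]
    change Submodule.Quotient.mk _ = Submodule.Quotient.mk _
    rw [TensorProduct.smul_tmul, hℓ]

/-- The module induced from a line that is generated by an idempotent is projective. -/
theorem ExtendedModule.projective {s : V} (ℓ : V →ₗ[F] F) (hℓ : ∀ c, ℓ c • s = c)
    (ε : A →ₐ[F] F) (hε : ∀ a (c : V), a • c = ε a • c) {e : A}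
    (he : ∀ a, a * e = ε a • e) (hes : ε e = 1) : Module.Projective B (ExtendedModule f V) := by
  -- The map `b ⊗ c ↦ ℓ(c) b f(e)` respects the tensor relations because `a * e = ε a • e`.
  -- Following it by `b ↦ b ⊗ s` gives `b ⊗ e c = ε(e) (b ⊗ c)`, so the module is a summand of `B`.
  let i : ExtendedModule f V →ₗ[B] B :=
    ExtendedModule.lift f (ℓ.smulRight (f e)) fun a c => by
      rw [hε, LinearMap.smulRight_apply, LinearMap.smulRight_apply, map_smul, smul_eq_mul,
        smul_eq_mul, mul_smul_comm, ← map_mul, he, map_smul, smul_smul, mul_comm]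
  refine Module.Projective.of_split i
    (LinearMap.toSpanSingleton B _ (ExtendedModule.mk f 1 s)) (ExtendedModule.hom_ext fun b c => ?_)
  rw [LinearMap.comp_apply, ExtendedModule.lift_mk, LinearMap.toSpanSingleton_apply,
    ExtendedModule.smul_mk, mul_one, LinearMap.smulRight_apply, smul_eq_mul, mul_smul_comm,
    LinearMap.id_apply]
  have h1 : ExtendedModule.mk f (ℓ c • (b * f e)) s = ExtendedModule.mk f (b * f e) (ℓ c • s) := by
    change Submodule.Quotient.mk _ = Submodule.Quotient.mk _
    rw [TensorProduct.smul_tmul]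
  rw [h1, hℓ, ExtendedModule.mk_mul, hε, hes, one_smul]

end ExtendedModules

/-! ### Reduced enveloping algebras and twisting by a character -/

section ReducedEnvelopingAlgebras

attribute [local instance 100] LieRing.ofAssociativeRing

variable (p : ℕ) {F : Type u} {L : Type v} [Field F] [LieRing L] [LieAlgebra F L]
  [RestrictedLieAlgebra p F L] (χ : Module.Dual F L)

/-- The canonical map `L → u(L, χ)`. -/
noncomputable def reducedι : L →ₗ[F] ReducedEnveloping p χ :=
  (RingQuot.mkAlgHom F (ReducedRel p χ)).toLinearMap ∘ₗ
    ((UniversalEnvelopingAlgebra.ι F : L →ₗ⁅F⁆ UniversalEnvelopingAlgebra F L) : L →ₗ[F] _)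

theorem reducedι_apply (a : L) : reducedι p χ a =
    RingQuot.mkAlgHom F (ReducedRel p χ) (UniversalEnvelopingAlgebra.ι F a) :=
  rfl

theorem reducedι_lie (a b : L) : reducedι p χ ⁅a, b⁆ =
    reducedι p χ a * reducedι p χ b - reducedι p χ b * reducedι p χ a := by
  rw [reducedι_apply, LieHom.map_lie, LieRing.of_associative_ring_bracket, map_sub, map_mul,
    map_mul]
  rfl

theorem reducedι_pow (a : L) : reducedι p χ a ^ p =
    reducedι p χ (pMap p F a) + algebraMap F (ReducedEnveloping p χ) (χ a ^ p) := by
  have h := RingQuot.mkAlgHom_rel F (ReducedRel.pow (p := p) (χ := χ) a)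
  rw [map_sub, map_pow, AlgHom.commutes, sub_eq_iff_eq_add'] at h
  exact h

theorem UniversalEnvelopingAlgebra.adjoin_range_ι :
    Algebra.adjoin F (Set.range (UniversalEnvelopingAlgebra.ι F : L → _)) = ⊤ := by
  have hs : Function.Surjective (UniversalEnvelopingAlgebra.mkAlgHom F L) :=
    RingCon.mk'_surjective (UniversalEnvelopingAlgebra.ringCon F L)
  have h := congrArg (Subalgebra.map (UniversalEnvelopingAlgebra.mkAlgHom F L))
    (TensorAlgebra.adjoin_range_ι (R := F) (M := L))
  rw [AlgHom.map_adjoin, Algebra.map_top, (AlgHom.range_eq_top _).2 hs, ← Set.range_comp] at h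
  exact h

theorem adjoin_range_reducedι : Algebra.adjoin F (Set.range (reducedι p χ)) = ⊤ := by
  have h := congrArg (Subalgebra.map (RingQuot.mkAlgHom F (ReducedRel p χ)))
    (UniversalEnvelopingAlgebra.adjoin_range_ι (F := F) (L := L))
  rw [AlgHom.map_adjoin, Algebra.map_top,
    (AlgHom.range_eq_top _).2 (RingQuot.mkAlgHom_surjective F (ReducedRel p χ)),
    ← Set.range_comp] at h
  exact h

theorem reducedInclusion_reducedι (H : PSubalgebra p F L) (a : H.toLieSubalgebra) :
    reducedInclusion p H χ (reducedι p (H.restrictForm χ) a) = reducedι p χ (a : L) := by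
  rw [reducedι_apply, reducedInclusion, RingQuot.liftAlgHom_mkAlgHom_apply, AlgHom.comp_apply,
    UniversalEnvelopingAlgebra.lift_ι_apply]
  rfl

variable {p χ}

theorem HasPCharacter.action_reducedι {V : Type w} [AddCommGroup V] [Module F V]
    [LieRingModule L V] [LieModule F L V] (h : HasPCharacter p χ V) (a : L) :
    h.action (reducedι p χ a) = LieModule.toEnd F L V a := by
  rw [reducedι_apply, HasPCharacter.action, RingQuot.liftAlgHom_mkAlgHom_apply,
    UniversalEnvelopingAlgebra.lift_ι_apply]

theorem HasPCharacter.action_restrict {V : Type w} [AddCommGroup V] [Module F V]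
    [LieRingModule L V] [LieModule F L V] (h : HasPCharacter p χ V) (H : PSubalgebra p F L) :
    (h.restrict H).action = h.action.comp (reducedInclusion p H χ) := by
  refine AlgHom.ext_of_adjoin_eq_top (adjoin_range_reducedι p (H.restrictForm χ)) ?_
  rintro _ ⟨a, rfl⟩
  rw [HasPCharacter.action_reducedι, AlgHom.comp_apply, reducedInclusion_reducedι,
    HasPCharacter.action_reducedι]
  rfl

instance {V : Type w} [AddCommGroup V] [Module F V] [LieRingModule L V] [LieModule F L V]
    (h : HasPCharacter p χ V) : IsScalarTower F (ReducedEnveloping p χ) h.AsModule where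
  smul_assoc c a v := LinearMap.congr_fun (map_smul h.action c a) (v : V)

/-- The translates `a - ε(a)` of the generators of `u(L, χ)` by a character `ε`. -/
noncomputable def twistedι (ε : ReducedEnveloping p χ →ₐ[F] F) : L →ₗ[F] ReducedEnveloping p χ :=
  reducedι p χ - Algebra.linearMap F (ReducedEnveloping p χ) ∘ₗ ε.toLinearMap ∘ₗ reducedι p χ

theorem twistedι_apply (ε : ReducedEnveloping p χ →ₐ[F] F) (a : L) :
    twistedι ε a = reducedι p χ a - algebraMap F _ (ε (reducedι p χ a)) :=
  rfl

variable (ε : ReducedEnveloping p χ →ₐ[F] F)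

theorem apply_twistedι (a : L) : ε (twistedι ε a) = 0 := by
  rw [twistedι_apply, map_sub, AlgHom.commutes, Algebra.algebraMap_self_apply, sub_self]

theorem twistedι_lie (a b : L) :
    twistedι ε ⁅a, b⁆ = twistedι ε a * twistedι ε b - twistedι ε b * twistedι ε a := by
  have h : ε (reducedι p χ ⁅a, b⁆) = 0 := by
    rw [reducedι_lie, map_sub, map_mul, map_mul, mul_comm, sub_self]
  rw [twistedι_apply, h, map_zero, sub_zero, reducedι_lie, twistedι_apply, twistedι_apply]
  have h1 := Algebra.commutes (ε (reducedι p χ a)) (reducedι p χ b)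
  have h2 := Algebra.commutes (ε (reducedι p χ b)) (reducedι p χ a)
  have h3 := Algebra.commutes (ε (reducedι p χ a))
    (algebraMap F (ReducedEnveloping p χ) (ε (reducedι p χ b)))
  simp only [sub_mul, mul_sub, h1, h2, h3]
  abel

/-- Subtracting a central scalar commutes with `p`-th powers in characteristic `p`, and the term
`χ(a)^p` occurs in both `a^p` and `ε(a)^p`, so it cancels. Twisting thus reduces to restricted
representations. -/
theorem twistedι_pMap [Fact p.Prime] [CharP F p] (a : L) :
    twistedι ε (pMap p F a) = twistedι ε a ^ p := by
  have : Nontrivial (ReducedEnveloping p χ) := ε.toRingHom.domain_nontrivial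
  have : CharP (ReducedEnveloping p χ) p :=
    charP_of_injective_algebraMap (algebraMap F (ReducedEnveloping p χ)).injective p
  have h := congrArg ε (reducedι_pow p χ a)
  rw [map_pow, map_add, AlgHom.commutes, Algebra.algebraMap_self_apply] at h
  rw [twistedι_apply, twistedι_apply,
    sub_pow_char_of_commute _ (Algebra.commutes _ _).symm,
    ← map_pow (algebraMap F (ReducedEnveloping p χ)), h, reducedι_pow,
    map_add, add_sub_add_right_eq_sub]

theorem reducedInclusion_twistedι (H : PSubalgebra p F L) (a : H.toLieSubalgebra) :
    reducedInclusion p H χ (twistedι (ε.comp (reducedInclusion p H χ)) a) =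
      twistedι ε (a : L) := by
  rw [twistedι_apply, map_sub, AlgHom.commutes, AlgHom.comp_apply, reducedInclusion_reducedι,
    twistedι_apply]

/-- A one-dimensional module is given by a character of `u(L, χ)`. -/
theorem HasPCharacter.exists_character {S : Type w} [AddCommGroup S] [Module F S]
    [LieRingModule L S] [LieModule F L S] (hdim : Module.finrank F S = 1)
    (hS : HasPCharacter p χ S) :
    ∃ ε : ReducedEnveloping p χ →ₐ[F] F, ∀ a v, hS.action a v = ε a • v := by
  have hb : Function.Bijective (algebraMap F (Module.End F S)) := by
    refine Algebra.finrank_eq_one_iff_bijective_algebraMap.1 ?_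
    have : Module.Finite F S := Module.finite_of_finrank_eq_succ hdim
    rw [Module.finrank_linearMap, hdim]
  let i : F ≃ₐ[F] Module.End F S := AlgEquiv.ofBijective (Algebra.ofId F _) hb
  refine ⟨(i.symm : Module.End F S →ₐ[F] F).comp hS.action, fun a v => ?_⟩
  have h : algebraMap F (Module.End F S) (i.symm (hS.action a)) = hS.action a :=
    i.apply_symm_apply (hS.action a)
  conv_lhs => rw [← h]
  rfl

/-- A character `ε` of the reduced enveloping algebra of a torus is afforded by the left ideal
generated by some `e` with `ε e = 1`. -/
theorem PSubalgebra.IsTorus.exists_idempotent [Fact p.Prime] [CharP F p] [Module.Finite F L]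
    {T : PSubalgebra p F L} (hT : T.IsTorus) {χ : Module.Dual F T.toLieSubalgebra}
    (ε : ReducedEnveloping p χ →ₐ[F] F) :
    ∃ e : ReducedEnveloping p χ, (∀ a, a * e = ε a • e) ∧ ε e = 1 := by
  have hab := hT.1
  obtain ⟨e, he, he'⟩ := exists_annihilating_idempotent (Fact.out : p.Prime).two_le (twistedι ε)
    (fun s t => by
      rw [← sub_eq_zero, ← twistedι_lie, trivial_lie_zero, map_zero])
    (pMap p F) (twistedι_pMap ε) hT.span_range_pMap
  refine ⟨e, fun a => ?_, ?_⟩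
  · have ha : a ∈ Algebra.adjoin F (Set.range (reducedι p χ)) :=
      adjoin_range_reducedι p χ ▸ Algebra.mem_top
    induction ha using Algebra.adjoin_induction with
    | mem a ha =>
      obtain ⟨t, rfl⟩ := ha
      have := he t
      rwa [twistedι_apply, sub_mul, sub_eq_zero, ← Algebra.smul_def] at this
    | algebraMap r => rw [AlgHom.commutes, Algebra.algebraMap_self_apply, Algebra.smul_def]
    | add a b _ _ ha hb => rw [add_mul, ha, hb, map_add, add_smul]
    | mul a b _ _ ha hb =>
      rw [mul_assoc, hb, mul_smul_comm, ha, smul_smul, map_mul, mul_comm]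
  · have h0 : ε (1 - e) = 0 := by
      generalize 1 - e = g at he'
      induction he' using NonUnitalAlgebra.adjoin_induction with
      | mem a ha =>
        obtain ⟨t, rfl⟩ := ha
        exact apply_twistedι ε t
      | add a b _ _ ha hb => rw [map_add, ha, hb, add_zero]
      | zero => exact map_zero ε
      | mul a b _ _ ha hb => rw [map_mul, ha, zero_mul]
      | smul c a _ ha => rw [map_smul, ha, smul_zero]
    rw [map_sub, map_one, sub_eq_zero] at h0
    exact h0.symm

/-- For solvable `L`, a simple `u(L, χ)`-module in which some nonzero vector transforms under a
maximal torus by the character `ε` is one on which `u(L, χ)` acts through `ε`. -/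
theorem smul_eq_of_isSimpleModule [Fact p.Prime] [CharP F p] [Module.Finite F L]
    [LieAlgebra.IsSolvable L] {T : PSubalgebra p F L} (hT : T.IsMaximalTorus)
    {M : Type w} [AddCommGroup M] [Module (ReducedEnveloping p χ) M]
    [IsSimpleModule (ReducedEnveloping p χ) M] {m : M} (hm : m ≠ 0)
    (hTm : ∀ t ∈ T.toLieSubalgebra, twistedι ε t • m = 0) (a : ReducedEnveloping p χ) (n : M) :
    a • n = algebraMap F (ReducedEnveloping p χ) (ε a) • n := by
  let _ : Module F M := Module.compHom M (algebraMap F (ReducedEnveloping p χ))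
  have : IsScalarTower F (ReducedEnveloping p χ) M :=
    ⟨fun c b k => by rw [Algebra.smul_def, mul_smul]; rfl⟩
  have hmem : ∀ b, b ∈ Algebra.adjoin F (Set.range (reducedι p χ)) := fun b =>
    adjoin_range_reducedι p χ ▸ Algebra.mem_top
  let ρ : L →ₗ[F] Module.End F M :=
    (Algebra.lsmul F F M : ReducedEnveloping p χ →ₐ[F] _).toLinearMap ∘ₗ twistedι ε
  have hρ : ∀ b k, ρ b k = twistedι ε b • k := fun b k => rfl
  have h0 : ρ = 0 := by
    refine eq_zero_of_irreducible_of_torus_invariant (Fact.out : p.Prime).two_le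
      (fun b c => ?_) (fun b => ?_) (fun N hN => ?_) hT hm hTm
    · ext k
      simp only [hρ, LinearMap.sub_apply, Module.End.mul_apply, twistedι_lie, sub_smul, mul_smul]
    · change Algebra.lsmul F F M _ = (Algebra.lsmul F F M _) ^ p
      rw [← map_pow, ← twistedι_pMap]
    -- Twisted and original generators differ by scalars, so they have the same stable
    -- `F`-subspaces.
    · let N' : Submodule (ReducedEnveloping p χ) M :=
        { N with
          smul_mem' := fun b => by
            change ∀ k ∈ N, b • k ∈ N
            induction hmem b using Algebra.adjoin_induction with
            | mem b hb =>
              obtain ⟨c, rfl⟩ := hb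
              intro k hk
              have h1 := add_mem (hN c k hk) (N.smul_mem (ε (reducedι p χ c)) hk)
              rwa [hρ, twistedι_apply, sub_smul, algebraMap_smul, sub_add_cancel] at h1
            | algebraMap r =>
              intro k hk
              rw [algebraMap_smul]
              exact N.smul_mem r hk
            | add b c _ _ hb hc =>
              intro k hk
              rw [add_smul]
              exact add_mem (hb k hk) (hc k hk)
            | mul b c _ _ hb hc =>
              intro k hk
              rw [mul_smul]
              exact hb _ (hc k hk) }
      have hN' : ∀ k, k ∈ N' ↔ k ∈ N := fun k => Iff.rfl
      refine (eq_bot_or_eq_top N').imp (fun h => ?_) fun h => ?_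
      · ext k
        rw [← hN', h, Submodule.mem_bot, Submodule.mem_bot]
      · ext k
        rw [← hN', h]
        simp
  induction hmem a using Algebra.adjoin_induction generalizing n with
  | mem b hb =>
    obtain ⟨c, rfl⟩ := hb
    have h1 : twistedι ε c • n = 0 := LinearMap.congr_fun (LinearMap.congr_fun h0 c) n
    rwa [twistedι_apply, sub_smul, sub_eq_zero] at h1
  | algebraMap r => rw [AlgHom.commutes, Algebra.algebraMap_self_apply]
  | add b c _ _ hb hc => rw [add_smul, hb, hc, map_add, map_add, add_smul]
  | mul b c _ _ hb hc => rw [mul_smul, hc, hb, ← mul_smul, map_mul, map_mul]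

end ReducedEnvelopingAlgebras

/-! ### The projective cover of a one-dimensional module -/

theorem mainTheorem5 (p : ℕ) [Fact p.Prime] (F : Type u) [Field F] [CharP F p]
    (L : Type v) [LieRing L] [LieAlgebra F L] [RestrictedLieAlgebra p F L]
    [Module.Finite F L] [LieAlgebra.IsSolvable L]
    (χ : Module.Dual F L)
    (S : Type w) [AddCommGroup S] [Module F S] [LieRingModule L S] [LieModule F L S]
    (hdim : Module.finrank F S = 1) (hS : HasPCharacter p χ S)
    (T : PSubalgebra p F L) (hT : T.IsMaximalTorus) :
    (∃ π : InducedModule χ T (hS.restrict T) →ₗ[ReducedEnveloping p χ] hS.AsModule,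
      IsProjectiveCover π) ∧
    ∀ (P : Type x) [AddCommGroup P] [Module (ReducedEnveloping p χ) P]
      (π : P →ₗ[ReducedEnveloping p χ] hS.AsModule), IsProjectiveCover π →
      Nonempty (P ≃ₗ[ReducedEnveloping p χ] InducedModule χ T (hS.restrict T)) := by
  obtain ⟨ε, hε⟩ := hS.exists_character hdim
  have hεS : ∀ (a : ReducedEnveloping p χ) (c : hS.AsModule), a • c = ε a • c := hε
  let ε' := ε.comp (reducedInclusion p T χ)
  have hact : ∀ (a : ReducedEnveloping p (T.restrictForm χ)) (c : S),
      (hS.restrict T).action a c = hS.action (reducedInclusion p T χ a) c := fun a c => by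
    rw [hS.action_restrict T, AlgHom.comp_apply]
  have hε' : ∀ (a : ReducedEnveloping p (T.restrictForm χ)) (c : (hS.restrict T).AsModule),
      a • c = ε' a • c := fun a c => (hact a c).trans (hε _ c)
  let b := Module.basisUnique Unit hdim
  let s : S := b ()
  have hs0 : s ≠ 0 := b.ne_zero ()
  let ℓ : S →ₗ[F] F := b.coord ()
  have hℓ : ∀ c : S, ℓ c • s = c := fun c => by
    have := b.sum_repr c
    rw [Fintype.sum_unique] at this
    exact this
  let f := reducedInclusion p T χ
  let s' : (hS.restrict T).AsModule := s
  let ℓ' : (hS.restrict T).AsModule →ₗ[F] F := ℓ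
  let g : InducedModule χ T (hS.restrict T) := ExtendedModule.mk f 1 s'
  have hgen : ∀ n : InducedModule χ T (hS.restrict T), ∃ a : ReducedEnveloping p χ, a • g = n :=
    ExtendedModule.exists_smul_mk f ℓ' hℓ
  let j : (hS.restrict T).AsModule →ₗ[F] hS.AsModule := (LinearMap.id : S →ₗ[F] S)
  let π : InducedModule χ T (hS.restrict T) →ₗ[ReducedEnveloping p χ] hS.AsModule :=
    ExtendedModule.lift f j hact
  have hπ : ∀ a, π (a • g) = ε a • j s' := fun a => by
    have hg : π g = j s' := (ExtendedModule.lift_mk f j hact 1 s').trans (one_smul _ _)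
    rw [map_smul, hg, hεS]
  have hcover : IsProjectiveCover π := by
    obtain ⟨e, he, he1⟩ := hT.1.exists_idempotent ε'
    refine ⟨ExtendedModule.projective f ℓ' hℓ ε' hε' he he1, fun c => ?_, fun n hn => ?_⟩
    · refine ⟨algebraMap F (ReducedEnveloping p χ) (ℓ c) • g, ?_⟩
      rw [hπ, AlgHom.commutes]
      exact hℓ c
    · refine Submodule.mem_sInf.2 fun N hN => ?_
      obtain ⟨a, rfl⟩ := hgen n
      rw [LinearMap.mem_ker, hπ] at hn
      have hεa : ε a = 0 := (smul_eq_zero.1 hn).resolve_right hs0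
      -- It suffices that `a` acts by zero on the simple quotient by `N`, which the image of `g`
      -- generates.
      have : IsSimpleModule (ReducedEnveloping p χ) (_ ⧸ N) := isSimpleModule_iff_isCoatom.2 hN
      have hg : N.mkQ g ≠ 0 := by
        intro h
        refine hN.1 (top_le_iff.1 fun k _ => ?_)
        obtain ⟨c, rfl⟩ := hgen k
        exact N.smul_mem c ((Submodule.Quotient.mk_eq_zero N).1 h)
      have hTg : ∀ t ∈ T.toLieSubalgebra, twistedι ε t • N.mkQ g = 0 := by
        intro t ht
        -- A twisted element of `T` moves across the tensor sign and acts on `S` by `ε` of it, which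
        -- is zero.
        have h1 : twistedι ε t • g = 0 := by
          rw [ExtendedModule.smul_mk, mul_one, ← one_mul (twistedι ε t),
            ← reducedInclusion_twistedι ε T ⟨t, ht⟩, ExtendedModule.mk_mul, hε',
            apply_twistedι, zero_smul]
          exact congrArg Submodule.Quotient.mk (TensorProduct.tmul_zero _ _)
        rw [← map_smul, h1, map_zero]
      have h2 := smul_eq_of_isSimpleModule ε hT hg hTg a (N.mkQ g)
      rw [hεa, map_zero, zero_smul, ← map_smul] at h2
      exact (Submodule.Quotient.mk_eq_zero N).1 h2
  refine ⟨⟨π, hcover⟩, fun P _ _ π' hπ' => ?_⟩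
  have : Module.Finite (ReducedEnveloping p χ) (InducedModule χ T (hS.restrict T)) :=
    ⟨⟨{g}, top_le_iff.1 fun n _ => by
      rw [Finset.coe_singleton]
      exact Submodule.mem_span_singleton.2 (hgen n)⟩⟩
  exact hπ'.nonempty_linearEquiv hcover
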